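/- Let $F$ be a non-trivial free group (of arbitrary, possibly infinite, rank) and let $A<F$ be a finitely generated subgroup. Let $\operatorname{rk}(A)$ denote the minimal number of generators of $A$. A subgroup $M<F$ is called maximal cyclic if it is cyclic and not properly contained in any cyclic subgroup of $F$. Then there are at most $\operatorname{rk}(A)$ conjugacy classes (under conjugation by $F$) of maximal cyclic subgroups $M<F$ such that \[ 12\cdot\operatorname{rk}(A)\leq[M:A\cap M]<\infty . \] Here a conjugacy class is counted if at least one of its members $M$ satisfies the displayed inequalities. -/

import Mathlib

/-- `M` is a maximal cyclic subgroup: it is cyclic and is contained in no strictly larger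
cyclic subgroup. -/
def IsMaximalCyclic {G : Type*} [Group G] (M : Subgroup G) : Prop :=
  Maximal (fun H : Subgroup G => IsCyclic H) M

/-- The conjugacy class of a subgroup `M`: the set of all subgroups `g M g⁻¹`. -/
def subgroupConjClass {G : Type*} [Group G] (M : Subgroup G) : Set (Subgroup G) :=
  {N | ∃ g : G, N = M.map (MulAut.conj g).toMonoidHom}

/-- The conjugacy classes that are represented by some maximal cyclic subgroup `M` with
`12 * rk(A) ≤ [M : A ∩ M] < ∞`. The first condition on `relIndex` says that the index is finite
(the value `0` of `relIndex` encodes an infinite index). -/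
def longMaximalCyclicClasses {G : Type*} [Group G] (A : Subgroup G) [Group.FG A] :
    Set (Set (Subgroup G)) :=
  {c | ∃ M : Subgroup G, IsMaximalCyclic M ∧ (A ⊓ M).relIndex M ≠ 0 ∧
    12 * Group.rank A ≤ (A ⊓ M).relIndex M ∧ c = subgroupConjClass M}

/-! Let r = rk A. A maximal cyclic M = ⟨m⟩ with n = [M : A ∩ M] finite gives a closed immersed path
of length n·p in the Schreier graph on F/A, where p is the length of the cyclic reduction of m.
Finitely many such paths span a finite graph without leaves, and the Euler characteristic bounds the
sum of deg v − 2 by 2r − 2 (`card_directedEdges_add_two_le`).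

Each position on a path carries a rotation of its word. Positions over one vertex carry distinct
rotations, because ⟨m⟩ is its own centralizer. Fix a conjugation-invariant linear order on F
(`exists_linearOrder_conj_le`) and call a position top if its rotation is the largest over its
vertex. Invariance transports comparisons along edges, and counting edges shows that the top status
changes at most 2r − 2 times (`card_top_change_add_le`). The same holds for bottom positions, and at
most 2r − 2 positions are alone over a vertex of degree at least 3. If n ≥ 12r, the path has 6r
disjoint blocks of two periods, so some block avoids all these positions. Every period contains a
top and a bottom position, so throughout that block each position is both: its vertices are visited
once and have degree two (`exists_window`).

Another path of no larger period that meets the start of this window must run along it, which makes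
rotations of the two words commute (`exists_commute_rot`); this is impossible for non-conjugate
maximal cyclic subgroups. Hence each path has an edge missed by all others of no larger period, and
the chains of the paths are independent (`linearIndependent_chain`). They are chains of loops, which
lie in a space spanned by r chains of generators of A. -/

namespace FreeGroup

/-! ### Magnus expansion and a conjugation-invariant order -/

variable {α : Type*}

/-- Multiplication by `1 + X a` from the left on noncommutative power series with coefficients
indexed by words. -/
def magnusLeft [DecidableEq α] (a : α) (f : List α → ℤ) : List α → ℤ
  | [] => f []
  | x :: l => f (x :: l) + if x = a then f l else 0

/-- The inverse of `magnusLeft`. -/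
def magnusLeftInv [DecidableEq α] (a : α) (f : List α → ℤ) : List α → ℤ
  | [] => f []
  | x :: l => f (x :: l) - if x = a then magnusLeftInv a f l else 0

/-- Multiplication by `1 + X a` from the right. -/
def magnusRight [DecidableEq α] (a : α) (f : List α → ℤ) (l : List α) : ℤ :=
  f l + if l.getLast? = some a then f l.dropLast else 0

/-- `magnusLeft` as a permutation. -/
def magnusPerm [DecidableEq α] (a : α) : Equiv.Perm (List α → ℤ) where
  toFun := magnusLeft a
  invFun := magnusLeftInv a
  left_inv f := by
    funext l
    induction l with
    | nil => rfl
    | cons x l ih => simp [magnusLeft, magnusLeftInv, ih]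
  right_inv f := by
    funext l
    cases l <;> simp [magnusLeft, magnusLeftInv]

/-- The power series `1`. -/
def magnusOne : List α → ℤ
  | [] => 1
  | _ :: _ => 0

/-- The action of the free group on power series by left multiplication through the Magnus
embedding. -/
def magnusAct [DecidableEq α] : FreeGroup α →* Equiv.Perm (List α → ℤ) := lift magnusPerm

/-- The Magnus expansion. -/
def magnus [DecidableEq α] (g : FreeGroup α) : List α → ℤ := magnusAct g magnusOne

/-- Well-foundedness lets two series be compared at their first difference. Putting length first
means that multiplying by `1 + X a` adds to a coefficient only one at a smaller word, so the first
difference survives. -/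
lemma exists_wellOrder_list (α : Type*) : ∃ _ : LinearOrder (List α), WellFoundedLT (List α) ∧
    ∀ l m : List α, l.length < m.length → l < m := by
  classical
  let o : LinearOrder (List α) := linearOrderOfSTO WellOrderingRel
  have hwf : WellFoundedLT (List α) := ⟨IsWellFounded.wf (r := WellOrderingRel)⟩
  let f : List α → ℕ ×ₗ List α := fun l => toLex (l.length, l)
  have hf : Function.Injective f := fun l m h => congrArg Prod.snd (toLex.injective h)
  refine ⟨LinearOrder.lift' f hf, ⟨InvImage.wf f wellFounded_lt⟩, fun l m h => ?_⟩
  exact Prod.Lex.toLex_lt_toLex.mpr (Or.inl h)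

variable [DecidableEq α]

lemma magnusLeft_magnusRight_comm (a b : α) (f : List α → ℤ) :
    magnusLeft a (magnusRight b f) = magnusRight b (magnusLeft a f) := by
  funext l
  match l with
  | [] => simp [magnusLeft, magnusRight]
  | [x] => simp [magnusLeft, magnusRight]; ring
  | x :: y :: l =>
    simp only [magnusLeft, magnusRight, List.getLast?_cons_cons, List.dropLast_cons_cons]
    split_ifs <;> ring

lemma magnusLeft_one (a : α) : magnusLeft a magnusOne = magnusRight a magnusOne := by
  funext l
  match l with
  | [] => simp [magnusLeft, magnusRight]
  | [x] => simp [magnusLeft, magnusRight, magnusOne]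
  | x :: y :: l => simp [magnusLeft, magnusRight, magnusOne]

lemma magnusAct_magnusRight_comm (g : FreeGroup α) (b : α) (f : List α → ℤ) :
    magnusAct g (magnusRight b f) = magnusRight b (magnusAct g f) := by
  induction g using FreeGroup.induction_on generalizing f with
  | C1 => simp
  | of a => simpa [magnusAct, magnusPerm] using magnusLeft_magnusRight_comm a b f
  | inv_of a h =>
    rw [_root_.map_inv, Equiv.Perm.inv_eq_iff_eq, h]
    simp
  | mul g h hg hh => simp [hg, hh]

lemma magnus_of_mul (a : α) (g : FreeGroup α) : magnus (of a * g) = magnusLeft a (magnus g) := by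
  simp [magnus, magnusAct, magnusPerm]

/-- The action is defined by left multiplication only; right multiplication commutes with it and
agrees with it on the series `1`. -/
lemma magnus_mul_of (a : α) (g : FreeGroup α) : magnus (g * of a) = magnusRight a (magnus g) := by
  rw [magnus, magnus, ← magnusAct_magnusRight_comm, ← magnusLeft_one]
  simp [magnusAct, magnusPerm]

/-- A reduced word whose first letter is `a` has a nonzero coefficient at a word `a :: l` without
repetitions of adjacent letters, and no nonzero coefficient at longer ones. -/
lemma exists_magnus_ne_zero (L : List (α × Bool)) (x : α × Bool) (h : IsReduced (x :: L)) :
    ∃ l k, (x.1 :: l).IsChain (· ≠ ·) ∧ 0 < k ∧ magnus (mk (x :: L)) l ≠ 0 ∧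
      magnus (mk (x :: L)) (x.1 :: l) = (if x.2 then k else -k) * magnus (mk (x :: L)) l ∧
      (∀ m : List α, m.IsChain (· ≠ ·) → l.length < m.length → m.head? ≠ some x.1 →
        magnus (mk (x :: L)) m = 0) ∧
      ∀ m : List α, m.IsChain (· ≠ ·) → l.length + 1 < m.length → magnus (mk (x :: L)) m = 0 := by
  have step (y : α × Bool) (L) (m : List α) : magnus (mk (y :: L)) m =
      if y.2 then magnusLeft y.1 (magnus (mk L)) m else magnusLeftInv y.1 (magnus (mk L)) m := by
    obtain ⟨a, b⟩ := y
    have : (mk ((a, b) :: L) : FreeGroup α) = mk [(a, b)] * mk L := by simp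
    rw [this]
    cases b
    · have : (mk [(a, false)] : FreeGroup α) = (of a)⁻¹ := by simp [of, invRev]
      simp [this, magnus, magnusAct, magnusPerm, Equiv.Perm.inv_def]
    · change magnus (of a * mk L) m = _
      simp [magnus_of_mul]
  have stay (y : α × Bool) (L) (m : List α) (hm : m.head? ≠ some y.1) :
      magnus (mk (y :: L)) m = magnus (mk L) m := by
    rw [step]
    cases m with
    | nil => simp [magnusLeft, magnusLeftInv]
    | cons z m =>
      simp only [List.head?_cons, ne_eq, Option.some.injEq] at hm
      simp [magnusLeft, magnusLeftInv, hm]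
  have move (y : α × Bool) (L) (m : List α) (hm : m.head? ≠ some y.1) :
      magnus (mk (y :: L)) (y.1 :: m) =
        magnus (mk L) (y.1 :: m) + (if y.2 then 1 else -1) * magnus (mk L) m := by
    have h1 := stay y L m hm
    rw [step] at h1 ⊢
    cases hy : y.2
    · simp only [hy, Bool.false_eq_true, if_false] at h1 ⊢
      simp [magnusLeftInv, h1]; ring
    · simp [magnusLeft]
  have tail_head (a : α) (m : List α) (hm : (a :: m).IsChain (· ≠ ·)) : m.head? ≠ some a := by
    cases m with
    | nil => simp
    | cons b m => simp at hm ⊢; exact fun e => hm.1 e.symm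
  induction L generalizing x with
  | nil =>
    have h1 : (magnus (mk [] : FreeGroup α)) = magnusOne := by
      change magnus (1 : FreeGroup α) = _
      simp [magnus]
    refine ⟨[], 1, by simp, one_pos, ?_, ?_, ?_, ?_⟩
    · rw [stay _ _ _ (by simp), h1]; simp [magnusOne]
    · rw [move _ _ _ (by simp), stay _ _ _ (by simp), h1]; simp [magnusOne]
    · intro m hm hl hh
      rw [stay _ _ _ hh, h1]
      cases m <;> simp_all [magnusOne]
    · intro m hm hl
      match m with
      | [] => simp at hl
      | [z] => simp at hl
      | y :: z :: m =>
        by_cases hy : y = x.1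
        · subst hy
          rw [move _ _ _ (tail_head _ _ hm), h1]; simp [magnusOne]
        · rw [stay _ _ _ (by simpa using hy), h1]; simp [magnusOne]
  | cons y L ih =>
    have h' : IsReduced (y :: L) := h.infix ⟨[x], [], by simp⟩
    obtain ⟨l, k, hc, hk, h0, h1, h2, h3⟩ := ih y h'
    have hxy : x.1 = y.1 → x.2 = y.2 := by
      have := h; simp only [IsReduced, List.isChain_cons_cons] at this; exact this.1
    -- Here `k` is the length of the initial run of one letter, as in (1 + X)^(±k) = 1 ± kX + ⋯; it
    -- grows by one if the run continues. A new run prepends its letter to the longest word and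
    -- restarts at `k = 1`.
    by_cases he : x.1 = y.1
    · have hl := tail_head _ _ hc
      rw [← he] at hl hc
      refine ⟨l, k + 1, hc, by omega, ?_, ?_, ?_, ?_⟩
      · rwa [stay _ _ _ hl]
      · rw [move _ _ _ hl, stay _ _ _ hl, he, h1, hxy he]
        split_ifs <;> ring
      · intro m hm hlm hh
        rw [stay _ _ _ hh, h2 m hm hlm (he ▸ hh)]
      · intro m hm hlm
        cases m with
        | nil => simp at hlm
        | cons z m =>
          by_cases hz : z = x.1
          · subst hz
            have ht := tail_head _ _ hm
            have hm' : m.IsChain (· ≠ ·) := hm.tail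
            rw [move _ _ _ ht, h3 _ hm hlm, h2 m hm' (by simpa using hlm) (he ▸ ht)]
            simp
          · rw [stay _ _ _ (by simpa using hz), h3 _ hm hlm]
    · have hne : magnus (mk (y :: L)) (y.1 :: l) ≠ 0 := by
        rw [h1]
        refine mul_ne_zero ?_ h0
        split_ifs <;> omega
      have hch : (x.1 :: y.1 :: l).IsChain (· ≠ ·) := by
        rw [List.isChain_cons_cons]; exact ⟨he, hc⟩
      have hl := tail_head _ _ hch
      refine ⟨y.1 :: l, 1, hch, one_pos, ?_, ?_, ?_, ?_⟩
      · rwa [stay _ _ _ hl]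
      · rw [move _ _ _ hl, stay _ _ _ hl, h3 _ hch (by simp), zero_add]
      · intro m hm hlm hh
        rw [stay _ _ _ hh, h3 m hm (by simpa using hlm)]
      · intro m hm hlm
        cases m with
        | nil => simp at hlm
        | cons z m =>
          simp only [List.length_cons] at hlm
          by_cases hz : z = x.1
          · subst hz
            rw [move _ _ _ (tail_head _ _ hm), h3 _ hm (by simp; omega),
              h3 m hm.tail (by omega)]
            simp
          · rw [stay _ _ _ (by simpa using hz), h3 _ hm (by simp; omega)]

lemma magnus_injective : Function.Injective (magnus : FreeGroup α → List α → ℤ) := by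
  have key (g : FreeGroup α) (hg : magnus g = magnusOne) : g = 1 := by
    rw [← toWord_eq_nil_iff]
    cases hw : g.toWord with
    | nil => rfl
    | cons x L =>
      obtain ⟨l, k, -, hk, h0, h1, -, -⟩ :=
        exists_magnus_ne_zero L x (hw ▸ isReduced_toWord)
      rw [← hw, mk_toWord, hg] at h0 h1
      rw [show (magnusOne (x.1 :: l) : ℤ) = 0 from rfl] at h1
      have := mul_ne_zero (show (if x.2 then k else -k) ≠ 0 by split_ifs <;> omega) h0
      exact absurd h1.symm this
  intro g h hgh
  have : magnus (h⁻¹ * g) = magnusOne := by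
    change magnusAct (h⁻¹ * g) magnusOne = _
    rw [_root_.map_mul, _root_.map_inv, Equiv.Perm.mul_apply, Equiv.Perm.inv_eq_iff_eq]
    exact hgh
  exact (inv_mul_eq_one.mp (key _ this)).symm

/-- Free groups carry a linear order that is invariant under conjugation. -/
theorem exists_linearOrder_conj_le (α : Type*) : ∃ _ : LinearOrder (FreeGroup α),
    ∀ g u v : FreeGroup α, u ≤ v → g * u * g⁻¹ ≤ g * v * g⁻¹ := by
  classical
  obtain ⟨o, hwf, hlen⟩ := exists_wellOrder_list α
  let o' : LinearOrder (FreeGroup α) :=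
    LinearOrder.lift' (fun g => toLex (magnus g)) (fun g h e => magnus_injective (toLex.injective e))
  have lt_iff (u v : FreeGroup α) : u < v ↔
      ∃ l, (∀ m < l, magnus u m = magnus v m) ∧ magnus u l < magnus v l := Iff.rfl
  have left_of (a : α) (u v : FreeGroup α) (h : u < v) : of a * u < of a * v := by
    rw [lt_iff] at h ⊢
    obtain ⟨l, h1, h2⟩ := h
    refine ⟨l, fun m hm => ?_, ?_⟩
    · rw [magnus_of_mul, magnus_of_mul]
      cases m with
      | nil => exact h1 _ hm
      | cons x m => simp [magnusLeft, h1 _ hm, h1 m ((hlen _ _ (by simp)).trans hm)]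
    · rw [magnus_of_mul, magnus_of_mul]
      cases l with
      | nil => exact h2
      | cons x m => simp [magnusLeft, h2, h1 m (hlen _ _ (by simp))]
  have right_of (a : α) (u v : FreeGroup α) (h : u < v) : u * of a < v * of a := by
    rw [lt_iff] at h ⊢
    obtain ⟨l, h1, h2⟩ := h
    have hd (l : List α) (hl : l ≠ []) : l.dropLast < l := hlen _ _ (by
      have := List.length_pos_iff.mpr hl
      simp; omega)
    refine ⟨l, fun m hm => ?_, ?_⟩
    · rw [magnus_mul_of, magnus_mul_of]
      by_cases hn : m = []
      · subst hn; simpa [magnusRight] using h1 _ hm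
      · simp only [magnusRight, h1 _ hm, h1 _ ((hd m hn).trans hm)]
    · rw [magnus_mul_of, magnus_mul_of]
      by_cases hn : l = []
      · subst hn; simpa [magnusRight] using h2
      · simp only [magnusRight, h1 _ (hd l hn)]; linarith
  have conj (g u v : FreeGroup α) (h : u < v) : g * u * g⁻¹ < g * v * g⁻¹ := by
    -- The order is total, so the inverse of a strictly monotone bijection is strictly monotone.
    have l_inv (a : α) (u v : FreeGroup α) (h : u < v) : (of a)⁻¹ * u < (of a)⁻¹ * v := by
      by_contra hc
      rcases (not_lt.mp hc).lt_or_eq with hc | hc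
      · have := left_of a _ _ hc
        simp only [mul_inv_cancel_left] at this
        exact lt_asymm h this
      · exact h.ne (mul_left_cancel hc).symm
    have r_inv (a : α) (u v : FreeGroup α) (h : u < v) : u * (of a)⁻¹ < v * (of a)⁻¹ := by
      by_contra hc
      rcases (not_lt.mp hc).lt_or_eq with hc | hc
      · have := right_of a _ _ hc
        simp only [inv_mul_cancel_right] at this
        exact lt_asymm h this
      · exact h.ne (mul_right_cancel hc).symm
    induction g using FreeGroup.induction_on generalizing u v with
    | C1 => simpa using h
    | of a => exact r_inv _ _ _ (left_of _ _ _ h)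
    | inv_of a _ => simpa using right_of a _ _ (l_inv a _ _ h)
    | mul x y hx hy =>
      have := hx _ _ (hy _ _ h)
      simpa [mul_assoc] using this
  refine ⟨o', fun g u v h => ?_⟩
  rcases h.lt_or_eq with h | h
  · exact (conj g u v h).le
  · rw [h]

end FreeGroup

/-! ### Chains on the Schreier graph and the Euler characteristic -/

namespace FreeGroup

section PathChain

variable {α X : Type*} [MulAction (FreeGroup α) X]

/-- The generator `a` acting on the skew product of `X` with the chains on its Schreier graph. -/
noncomputable def edgePerm (a : α) : Equiv.Perm (X × (X × α →₀ ℚ)) where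
  toFun p := (of a • p.1, p.2 + Finsupp.single (p.1, a) 1)
  invFun p := ((of a)⁻¹ • p.1, p.2 - Finsupp.single ((of a)⁻¹ • p.1, a) 1)
  left_inv p := by simp
  right_inv p := by simp

/-- The chain of the path that starts at `x` and is labelled by `g`, read from right to left. -/
noncomputable def pathChain (g : FreeGroup α) (x : X) : X × α →₀ ℚ :=
  (lift edgePerm g (x, 0)).2

/-- The generators commute with translations of the chain coordinate, so the action is determined at
the zero chain. This makes `pathChain` a cocycle. -/
lemma lift_edgePerm_apply (g : FreeGroup α) (x : X) (k : X × α →₀ ℚ) :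
    lift edgePerm g (x, k) = (g • x, k + pathChain g x) := by
  have trans (g : FreeGroup α) : ∀ (x : X) (k c : X × α →₀ ℚ),
      lift edgePerm g (x, k + c) =
        ((lift edgePerm g (x, c)).1, k + (lift edgePerm g (x, c)).2) := by
    induction g using FreeGroup.induction_on with
    | C1 => simp
    | of a => intro x k c; simp [edgePerm, add_assoc]
    | inv_of a _ =>
      intro x k c
      simp [edgePerm, Equiv.Perm.inv_def, add_sub_assoc]
    | mul g h hg hh =>
      intro x k c
      rw [_root_.map_mul, Equiv.Perm.mul_apply, Equiv.Perm.mul_apply, hh, hg]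
  have fst (g : FreeGroup α) : ∀ (x : X) (k : X × α →₀ ℚ), (lift edgePerm g (x, k)).1 = g • x := by
    induction g using FreeGroup.induction_on with
    | C1 => simp
    | of a => simp [edgePerm]
    | inv_of a _ => simp [edgePerm, Equiv.Perm.inv_def]
    | mul g h hg hh =>
      intro x k
      rw [_root_.map_mul, Equiv.Perm.mul_apply, ← Prod.mk.eta (p := lift edgePerm h (x, k)), hg, hh,
        mul_smul]
  have := trans g x k 0
  rw [add_zero] at this
  rw [this, fst, pathChain]

@[simp] lemma pathChain_of (a : α) (x : X) : pathChain (of a) x = Finsupp.single (x, a) 1 := by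
  simp [pathChain, edgePerm]

@[simp] lemma pathChain_one (x : X) : pathChain (1 : FreeGroup α) x = 0 := by
  simp [pathChain]

lemma pathChain_mul (g h : FreeGroup α) (x : X) :
    pathChain (g * h) x = pathChain h x + pathChain g (h • x) := by
  rw [pathChain, _root_.map_mul, Equiv.Perm.mul_apply, lift_edgePerm_apply, lift_edgePerm_apply,
    zero_add]

lemma pathChain_inv_smul (g : FreeGroup α) (x : X) :
    pathChain g⁻¹ (g • x) = -pathChain g x := by
  have := pathChain_mul g⁻¹ g x
  rw [inv_mul_cancel, pathChain_one] at this
  exact (neg_eq_of_add_eq_zero_right this.symm).symm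

lemma pathChain_inv (g : FreeGroup α) (x : X) :
    pathChain g⁻¹ x = -pathChain g (g⁻¹ • x) := by
  rw [← pathChain_inv_smul, smul_inv_smul]

/-- On the stabilizer the cocycle `pathChain` is a homomorphism, so generators of the group give
generators of the space of loop chains. -/
lemma pathChain_mem_span {x₀ : X} {s : Set (FreeGroup α)}
    (hs : Subgroup.closure s = MulAction.stabilizer (FreeGroup α) x₀)
    {g : FreeGroup α} (hg : g • x₀ = x₀) :
    pathChain g x₀ ∈ Submodule.span ℚ ((fun g => pathChain g x₀) '' s) := by
  replace hg : g ∈ Subgroup.closure s := hs ▸ hg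
  induction hg using Subgroup.closure_induction with
  | mem g h => exact Submodule.subset_span ⟨g, h, rfl⟩
  | one => simp
  | mul g h hg hh ihg ihh =>
    rw [hs] at hg hh
    rw [pathChain_mul, show h • x₀ = x₀ from hh]
    exact add_mem ihh ihg
  | inv g hg ih =>
    rw [hs] at hg
    have hg : g • x₀ = x₀ := hg
    have := pathChain_inv_smul g x₀
    rw [hg] at this
    rw [this]
    exact neg_mem ih

/-- Loops with independent chains are at most as many as generators of the stabilizer. -/
lemma card_le_of_linearIndependent_pathChain {x₀ : X} {s : Finset (FreeGroup α)}
    (hs : Subgroup.closure (s : Set (FreeGroup α)) = MulAction.stabilizer (FreeGroup α) x₀)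
    {ι : Type*} [Fintype ι] (c : ι → X × α →₀ ℚ) (hc : LinearIndependent ℚ c)
    (hg : ∀ i, ∃ g : FreeGroup α, g • x₀ = x₀ ∧ pathChain g x₀ = c i) :
    Fintype.card ι ≤ s.card := by
  classical
  have := linearIndependent_le_span_aux' c hc (s.image (fun g => pathChain g x₀) : Finset _) (by
    rintro _ ⟨i, rfl⟩
    obtain ⟨g, h, h'⟩ := hg i
    rw [← h', Finset.coe_image]
    exact pathChain_mem_span hs h)
  refine this.trans ?_
  simp only [Finset.coe_sort_coe, Fintype.card_coe]
  exact Finset.card_image_le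

/-- Euler characteristic bound for finite subgraphs of a Schreier graph. -/
lemma card_edges_lt {x₀ : X} [MulAction.IsPretransitive (FreeGroup α) X]
    {s : Finset (FreeGroup α)}
    (hs : Subgroup.closure (s : Set (FreeGroup α)) = MulAction.stabilizer (FreeGroup α) x₀)
    (E : Finset (X × α)) (V : Finset X) (hV : V.Nonempty)
    (hE : ∀ e ∈ E, e.1 ∈ V ∧ of e.2 • e.1 ∈ V) :
    E.card < s.card + V.card := by
  classical
  obtain ⟨v₀, hv₀⟩ := hV
  choose γ hγ using fun x : X => MulAction.exists_smul_eq (FreeGroup α) x₀ x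
  let b : X → X × α →₀ ℚ := fun v => pathChain (γ v) x₀ - pathChain (γ v₀) x₀
  let w : Finset (X × α →₀ ℚ) := s.image (fun g => pathChain g x₀) ∪ (V.erase v₀).image b
  have hb (v : X) (hv : v ∈ V) : b v ∈ Submodule.span ℚ (w : Set (X × α →₀ ℚ)) := by
    by_cases h : v = v₀
    · simp [b, h]
    · refine Submodule.subset_span ?_
      simp only [w, Finset.coe_union, Finset.coe_image]
      exact Or.inr ⟨v, by simp [h, hv], rfl⟩
  have key := linearIndependent_le_span_aux' (fun e : E => Finsupp.single (e : X × α) (1 : ℚ))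
    ((Finsupp.linearIndependent_single_one ℚ (X × α)).comp _ Subtype.val_injective) w (by
      rintro _ ⟨⟨⟨v, a⟩, he⟩, rfl⟩
      obtain ⟨h1, h2⟩ := hE _ he
      simp only at h1 h2
      -- The edge is closed up to a loop at `x₀` by the chosen paths to its ends. Its chain is that
      -- of the loop, corrected by `b` at the two ends; normalizing `b` to vanish at `v₀` saves one
      -- vector.
      have hg : ((γ (of a • v))⁻¹ * (of a * γ v)) • x₀ = x₀ := by
        rw [mul_smul, mul_smul, hγ, inv_smul_eq_iff, hγ]
      have h3 := pathChain_mem_span hs hg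
      rw [pathChain_mul, pathChain_mul, hγ, pathChain_of, mul_smul, hγ, pathChain_inv,
        inv_smul_eq_iff.mpr (hγ _).symm] at h3
      have h4 : Submodule.span ℚ ((fun g => pathChain g x₀) '' (s : Set (FreeGroup α))) ≤
          Submodule.span ℚ (w : Set (X × α →₀ ℚ)) := by
        refine Submodule.span_mono ?_
        simp [w]
      have h5 := add_mem (sub_mem (h4 h3) (hb _ h1)) (hb _ h2)
      rw [SetLike.mem_coe]
      convert h5 using 1
      simp only [b]
      abel)
  simp only [Finset.coe_sort_coe, Fintype.card_coe] at key
  have h1 : w.card ≤ s.card + (V.erase v₀).card :=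
    (Finset.card_union_le _ _).trans (add_le_add Finset.card_image_le Finset.card_image_le)
  rw [Finset.card_erase_of_mem hv₀] at h1
  have := Finset.card_pos.mpr ⟨v₀, hv₀⟩
  omega

end PathChain

end FreeGroup

/-! ### Closed immersed paths -/

namespace FreeGroup

/-- The inverse letter. -/
def flipLetter {α : Type*} (x : α × Bool) : α × Bool := (x.1, !x.2)

@[simp] lemma flipLetter_flipLetter {α : Type*} (x : α × Bool) :
    flipLetter (flipLetter x) = x := by
  simp [flipLetter]

/-- A letter as an element of the free group. -/
def letter {α : Type*} (x : α × Bool) : FreeGroup α := mk [x]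

lemma letter_flipLetter {α : Type*} (x : α × Bool) : letter (flipLetter x) = (letter x)⁻¹ := by
  simp [letter, flipLetter, invRev]

/-- The product of the first `n` letters of an infinite word, read from right to left. -/
def wordProd {α : Type*} (f : ℕ → α × Bool) : ℕ → FreeGroup α
  | 0 => 1
  | n + 1 => letter (f n) * wordProd f n

lemma wordProd_congr {α : Type*} {f g : ℕ → α × Bool} {n : ℕ} (h : ∀ k < n, f k = g k) :
    wordProd f n = wordProd g n := by
  induction n with
  | zero => rfl
  | succ n ih => rw [wordProd, wordProd, h n (by omega), ih fun k hk => h k (by omega)]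

lemma wordProd_add {α : Type*} (f : ℕ → α × Bool) (m n : ℕ) :
    wordProd f (m + n) = wordProd (fun k => f (m + k)) n * wordProd f m := by
  induction n with
  | zero => simp [wordProd]
  | succ n ih => rw [← add_assoc, wordProd, wordProd, ih, mul_assoc]

/-- A closed immersed path in the Schreier graph `X` whose label is a power of a cyclically reduced
word; `rot s` is the rotation of that word which is read from the position `s` on. -/
structure SchreierCycle (α X : Type*) [MulAction (FreeGroup α) X] where
  /-- the number of edges of the path -/
  length : ℕ
  /-- the length of the word -/
  period : ℕ
  length_pos : 0 < length
  period_pos : 0 < period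
  /-- the vertices of the path -/
  vert : ZMod length → X
  /-- the labels of the edges -/
  lab : ZMod length → α × Bool
  /-- the rotations of the word -/
  rot : ZMod length → FreeGroup α
  vert_succ : ∀ s, vert (s + 1) = letter (lab s) • vert s
  rot_succ : ∀ s, rot (s + 1) = letter (lab s) * rot s * (letter (lab s))⁻¹
  lab_succ_ne : ∀ s, lab (s + 1) ≠ flipLetter (lab s)
  lab_add_period : ∀ s, lab (s + period) = lab s
  rot_eq : ∀ s, rot s = wordProd (fun k => lab (s + k)) period
  ext_vert_rot : ∀ s t, vert s = vert t → rot s = rot t → s = t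

namespace SchreierCycle

variable {α X T : Type*} [MulAction (FreeGroup α) X] (c : SchreierCycle α X)

instance : NeZero c.length := ⟨c.length_pos.ne'⟩

/-- The two directions along the cycle. -/
def dir (b : Bool) : ZMod c.length := if b then 1 else -1

/-- The label of the edge that leaves the position `s` in the direction `b`. -/
def out (s : ZMod c.length) (b : Bool) : α × Bool :=
  if b then c.lab s else flipLetter (c.lab (s - 1))

lemma out_ne (s : ZMod c.length) (b : Bool) : c.out s b ≠ c.out s !b := by
  have h := c.lab_succ_ne (s - 1)
  rw [sub_add_cancel] at h
  cases b
  · simpa [out] using h.symm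
  · simpa [out] using h

lemma out_injective (s : ZMod c.length) : Function.Injective (c.out s) := by
  intro b b' h
  by_contra hne
  have : b' = !b := by cases b <;> cases b' <;> simp_all
  exact c.out_ne s b (this ▸ h)

lemma out_add_dir (s : ZMod c.length) (b : Bool) :
    c.out (s + c.dir b) (!b) = flipLetter (c.out s b) := by
  cases b <;> simp [out, dir, ← sub_eq_add_neg]

lemma vert_add_dir (s : ZMod c.length) (b : Bool) :
    c.vert (s + c.dir b) = letter (c.out s b) • c.vert s := by
  cases b
  · have h := c.vert_succ (s - 1)
    rw [sub_add_cancel] at h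
    simp only [out, dir, Bool.false_eq_true, if_false, ← sub_eq_add_neg, letter_flipLetter]
    rw [h, inv_smul_smul]
  · simpa [out, dir] using c.vert_succ s

lemma rot_add_dir (s : ZMod c.length) (b : Bool) :
    c.rot (s + c.dir b) = letter (c.out s b) * c.rot s * (letter (c.out s b))⁻¹ := by
  cases b
  · have h := c.rot_succ (s - 1)
    rw [sub_add_cancel] at h
    simp only [out, dir, Bool.false_eq_true, if_false, ← sub_eq_add_neg, letter_flipLetter]
    rw [h]
    group
  · simpa [out, dir] using c.rot_succ s

lemma lab_add_mul_period (s : ZMod c.length) (k : ℕ) :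
    c.lab (s + (k * c.period : ℕ)) = c.lab s := by
  induction k with
  | zero => simp
  | succ k ih =>
    rw [← ih, ← c.lab_add_period (s + (k * c.period : ℕ))]
    congr 1
    push_cast
    ring

lemma rot_congr {s t : ZMod c.length} (h : ∀ k : ℕ, c.lab (s + k) = c.lab (t + k)) :
    c.rot s = c.rot t := by
  rw [c.rot_eq, c.rot_eq]
  simp only [h]

lemma rot_add_mul_period (s : ZMod c.length) (k : ℕ) :
    c.rot (s + (k * c.period : ℕ)) = c.rot s := by
  refine c.rot_congr fun j => ?_
  rw [add_right_comm, lab_add_mul_period]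

/-! ### Top positions and the counting of edges -/

section Top

variable [LinearOrder T] (μ : FreeGroup α → T)

/-- The position `s` is on top of all positions over the same vertex. -/
def IsTop (s : ZMod c.length) : Prop := ∀ t, c.vert t = c.vert s → μ (c.rot t) ≤ μ (c.rot s)

variable {μ} (hμ : Function.Injective μ)
  (hconj : ∀ g u v, μ u ≤ μ v → μ (g * u * g⁻¹) ≤ μ (g * v * g⁻¹))

include hconj in
-- Moving along a common edge conjugates both rotations by the same letter, so being top at either
-- end decides the comparison at the start.
lemma rot_le_of_isTop {s t : ZMod c.length} {b b' : Bool} (hv : c.vert s = c.vert t)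
    (ho : c.out s b = c.out t b') (hs : c.IsTop μ s ∨ c.IsTop μ (s + c.dir b)) :
    μ (c.rot t) ≤ μ (c.rot s) := by
  rcases hs with hs | hs
  · exact hs t hv.symm
  · have h := hs (t + c.dir b') (by rw [vert_add_dir, vert_add_dir, hv, ho])
    rw [rot_add_dir, rot_add_dir, ho] at h
    have := hconj (letter (c.out t b'))⁻¹ _ _ h
    simpa [mul_assoc] using this

include hμ hconj in
lemma eq_of_isTop {s t : ZMod c.length} {b b' : Bool} (hv : c.vert s = c.vert t)
    (ho : c.out s b = c.out t b') (hs : c.IsTop μ s ∨ c.IsTop μ (s + c.dir b))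
    (ht : c.IsTop μ t ∨ c.IsTop μ (t + c.dir b')) : s = t :=
  c.ext_vert_rot _ _ hv (hμ (le_antisymm (c.rot_le_of_isTop hconj hv.symm ho.symm ht)
    (c.rot_le_of_isTop hconj hv ho hs)))

lemma exists_isTop (s : ZMod c.length) : ∃ t, c.vert t = c.vert s ∧ c.IsTop μ t := by
  classical
  obtain ⟨t, ht, hm⟩ := Finset.exists_max_image
    (Finset.univ.filter fun t => c.vert t = c.vert s) (fun t => μ (c.rot t)) ⟨s, by simp⟩
  simp only [Finset.mem_filter, Finset.mem_univ, true_and] at ht hm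
  exact ⟨t, ht, fun t' h => hm t' (h.trans ht)⟩

end Top

/-- `V` and `D` are the vertices and the directed edges of a finite subgraph of the Schreier graph
without leaves that contains the cycle `c`. -/
structure InGraph (V : Finset X) (D : Finset (X × (α × Bool))) [DecidableEq X] : Prop where
  fst_mem : ∀ d ∈ D, d.1 ∈ V
  two_le : ∀ v ∈ V, 2 ≤ (D.filter fun d => d.1 = v).card
  vert_mem : ∀ s, c.vert s ∈ V
  out_mem : ∀ s b, (c.vert s, c.out s b) ∈ D

section Count

variable {c} [DecidableEq X] {V : Finset X} {D : Finset (X × (α × Bool))} (h : c.InGraph V D)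

include h

open Classical in
-- Since `D.card - 2 * V.card` is the sum of deg v − 2 over `V`, with all terms nonnegative, every
-- branch vertex costs at least one.
lemma card_branch_add_le :
    (Finset.univ.filter fun s => (∀ t, c.vert t = c.vert s → t = s) ∧
      3 ≤ (D.filter fun d => d.1 = c.vert s).card).card + 2 * V.card ≤ D.card := by
  set U := Finset.univ.filter fun s => (∀ t, c.vert t = c.vert s → t = s) ∧
      3 ≤ (D.filter fun d => d.1 = c.vert s).card with hU
  have hinj : (U.image c.vert).card = U.card := by
    refine Finset.card_image_of_injOn fun s _ t ht e => ?_
    simp only [hU, Finset.coe_filter, Finset.mem_univ, true_and, Set.mem_ofPred_eq] at ht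
    exact ht.1 s e
  have hsub : U.image c.vert ⊆ V := by
    intro v hv
    obtain ⟨s, -, rfl⟩ := Finset.mem_image.mp hv
    exact h.vert_mem s
  rw [Finset.card_eq_sum_card_fiberwise (f := Prod.fst) (t := V) (s := D)
    (fun d hd => h.fst_mem d hd), ← hinj]
  calc _ = ∑ v ∈ V, ((if v ∈ U.image c.vert then 1 else 0) + 2) := by
        rw [Finset.sum_add_distrib, Finset.sum_ite_mem, Finset.inter_eq_right.mpr hsub]
        simp [mul_comm]
    _ ≤ _ := by
        refine Finset.sum_le_sum fun v hv => ?_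
        split_ifs with hm
        · obtain ⟨s, hs, rfl⟩ := Finset.mem_image.mp hm
          simp only [hU, Finset.mem_filter] at hs
          exact hs.2.2
        · simpa using h.two_le v hv

open Classical in
-- By `eq_of_isTop`, directed edges with a top position at one end are traversed injectively. Top
-- positions supply two outgoing edges for each visited vertex, and each change of status supplies
-- one more; unvisited vertices have degree at least two.
lemma card_top_change_add_le [LinearOrder T] {μ : FreeGroup α → T} (hμ : Function.Injective μ)
    (hconj : ∀ g u v, μ u ≤ μ v → μ (g * u * g⁻¹) ≤ μ (g * v * g⁻¹)) :
    (Finset.univ.filter fun s => ¬ (c.IsTop μ s ↔ c.IsTop μ (s + 1))).card + 2 * V.card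
      ≤ D.card := by
  set B := Finset.univ.filter fun s => ¬ (c.IsTop μ s ↔ c.IsTop μ (s + 1)) with hB
  let W : Finset X := Finset.univ.image c.vert
  -- Each change is oriented from its non-top end, which keeps these edges apart from those leaving
  -- top positions.
  let f : ZMod c.length → ZMod c.length × Bool := fun s =>
    if c.IsTop μ s then (s + 1, false) else (s, true)
  let Q₁ : Finset (ZMod c.length × Bool) := (Finset.univ.filter (c.IsTop μ)) ×ˢ Finset.univ
  let Q₂ : Finset (ZMod c.length × Bool) := B.image f
  have hQ₁ : 2 * W.card ≤ Q₁.card := by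
    rw [Finset.card_product, Finset.card_univ, Fintype.card_bool, mul_comm]
    refine Nat.mul_le_mul_right _ ((Finset.card_le_card ?_).trans
      (Finset.card_image_le (f := c.vert)))
    intro v hv
    obtain ⟨s, -, rfl⟩ := Finset.mem_image.mp hv
    obtain ⟨t, ht, htop⟩ := c.exists_isTop (μ := μ) s
    exact Finset.mem_image.mpr ⟨t, by simpa using htop, ht⟩
  have hQ₂ : Q₂.card = B.card := by
    refine Finset.card_image_of_injOn fun s _ t _ e => ?_
    simp only [f] at e
    split_ifs at e <;> simp_all
  have hf (s) (hs : s ∈ B) : ¬ c.IsTop μ (f s).1 ∧ c.IsTop μ ((f s).1 + c.dir (f s).2) := by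
    simp only [hB, Finset.mem_filter, Finset.mem_univ, true_and] at hs
    by_cases ht : c.IsTop μ s
    · simp_all [f, dir]
    · simp_all [f, dir]
  have hdisj : Disjoint Q₁ Q₂ := by
    rw [Finset.disjoint_right]
    intro q hq hq'
    obtain ⟨s, hs, rfl⟩ := Finset.mem_image.mp hq
    exact (hf s hs).1 (by simpa [Q₁] using hq')
  have hQ (q) (hq : q ∈ Q₁ ∪ Q₂) : c.IsTop μ q.1 ∨ c.IsTop μ (q.1 + c.dir q.2) := by
    rcases Finset.mem_union.mp hq with hq | hq
    · left; simpa [Q₁] using hq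
    · obtain ⟨s, hs, rfl⟩ := Finset.mem_image.mp hq
      exact Or.inr (hf s hs).2
  have h1 : (Q₁ ∪ Q₂).card ≤ (D.filter fun d => d.1 ∈ W).card := by
    refine Finset.card_le_card_of_injOn (fun q => (c.vert q.1, c.out q.1 q.2)) ?_ ?_
    · intro q _
      simpa [W] using h.out_mem q.1 q.2
    · intro q hq q' hq' e
      simp only [Prod.mk.injEq] at e
      have e1 := c.eq_of_isTop hμ hconj e.1 e.2 (hQ q hq) (hQ q' hq')
      obtain ⟨s, b⟩ := q
      obtain ⟨t, b'⟩ := q'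
      simp only at e1 e
      subst e1
      rw [c.out_injective s e.2]
  have h2 : 2 * (V \ W).card ≤ (D.filter fun d => d.1 ∉ W).card := by
    rw [Finset.card_eq_sum_card_fiberwise (f := Prod.fst) (t := V \ W)
      (fun d hd => by
        simp only [Finset.coe_filter, Set.mem_ofPred_eq] at hd
        simpa [hd.2] using h.fst_mem d hd.1), mul_comm, ← smul_eq_mul]
    refine Finset.card_nsmul_le_sum _ _ _ fun v hv => ?_
    rw [Finset.mem_sdiff] at hv
    refine (h.two_le v hv.1).trans (Finset.card_le_card fun d hd => ?_)
    simp only [Finset.mem_filter] at hd ⊢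
    exact ⟨⟨hd.1, hd.2 ▸ hv.2⟩, hd.2⟩
  have h3 : W ⊆ V := by
    intro v hv
    obtain ⟨s, -, rfl⟩ := Finset.mem_image.mp hv
    exact h.vert_mem s
  have h4 := Finset.card_sdiff_add_card_eq_card h3
  have h5 := Finset.card_filter_add_card_filter_not (s := D) (fun d => d.1 ∈ W)
  rw [Finset.card_union_of_disjoint hdisj] at h1
  omega

end Count

end SchreierCycle

end FreeGroup

/-! ### Windows in long cycles -/

namespace FreeGroup

/-- Flipping embeds the edges with negative letters into those with positive letters, so `D.card` is
at most twice the number of geometric edges. -/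
lemma card_directedEdges_add_two_le {α X : Type*} [MulAction (FreeGroup α) X]
    [MulAction.IsPretransitive (FreeGroup α) X] {x₀ : X} {s : Finset (FreeGroup α)}
    (hs : Subgroup.closure (s : Set (FreeGroup α)) = MulAction.stabilizer (FreeGroup α) x₀)
    {V : Finset X} {D : Finset (X × (α × Bool))} (hV : V.Nonempty) (hD : ∀ d ∈ D, d.1 ∈ V)
    (hflip : ∀ d ∈ D, (letter d.2 • d.1, flipLetter d.2) ∈ D) :
    D.card + 2 ≤ 2 * (s.card + V.card) := by
  classical
  let D' := D.filter fun d => d.2.2 = true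
  let E := D'.image fun d => (d.1, d.2.1)
  have hE : E.card = D'.card := by
    refine Finset.card_image_of_injOn ?_
    rintro ⟨v, a, b⟩ h ⟨v', a', b'⟩ h' e
    simp only [D', Finset.coe_filter, Set.mem_ofPred_eq] at h h'
    simp_all
  have h1 : (D.filter fun d => ¬ d.2.2 = true).card ≤ D'.card := by
    refine Finset.card_le_card_of_injOn (fun d => (letter d.2 • d.1, flipLetter d.2)) ?_ ?_
    · intro d hd
      simp only [Finset.coe_filter, Set.mem_ofPred_eq] at hd
      simp only [D', Finset.coe_filter, Set.mem_ofPred_eq]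
      exact ⟨hflip d hd.1, by simp [flipLetter, hd.2]⟩
    · rintro ⟨v, x⟩ - ⟨v', x'⟩ - e
      simp only [Prod.mk.injEq] at e
      have h2 : x = x' := by simpa using congrArg flipLetter e.2
      subst h2
      rw [smul_left_cancel _ e.1]
  have h2 := Finset.card_filter_add_card_filter_not (s := D) (fun d => d.2.2 = true)
  have h3 := card_edges_lt hs E V hV (by
    intro e he
    obtain ⟨⟨v, a, b⟩, hd, rfl⟩ := Finset.mem_image.mp he
    simp only [D', Finset.mem_filter] at hd
    obtain ⟨hd, rfl⟩ := hd
    exact ⟨hD _ hd, hD _ (hflip _ hd)⟩)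
  change D'.card + _ = _ at h2
  omega

namespace SchreierCycle

variable {α X T : Type*} [MulAction (FreeGroup α) X] (c : SchreierCycle α X)

/-- A globally largest rotation is largest over its vertex, and by periodicity it recurs in every
block of one period. -/
lemma exists_isTop_lt_period [LinearOrder T] (μ : FreeGroup α → T) (s : ZMod c.length) :
    ∃ m < c.period, c.IsTop μ (s + m) := by
  obtain ⟨t, -, ht⟩ := Finset.exists_max_image Finset.univ (fun t => μ (c.rot t))
    ⟨s, Finset.mem_univ s⟩
  refine ⟨(t - s).val % c.period, Nat.mod_lt _ c.period_pos, fun t' _ => ?_⟩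
  have h : c.rot (s + ((t - s).val % c.period : ℕ)) = c.rot t := by
    have h1 := c.rot_add_mul_period (s + ((t - s).val % c.period : ℕ)) ((t - s).val / c.period)
    rw [← h1, add_assoc, ← Nat.cast_add, mul_comm, Nat.mod_add_div, ZMod.natCast_zmod_val,
      add_sub_cancel]
  rw [h]
  exact ht t' (Finset.mem_univ _)

lemma forall_isTop [LinearOrder T] {μ : FreeGroup α → T} {s : ZMod c.length} {n : ℕ}
    (hn : c.period ≤ n)
    (h : ∀ m : ℕ, m < n → (c.IsTop μ (s + m) ↔ c.IsTop μ (s + m + 1))) :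
    ∀ m : ℕ, m ≤ n → c.IsTop μ (s + m) := by
  have h0 (m : ℕ) (hm : m ≤ n) : c.IsTop μ (s + m) ↔ c.IsTop μ s := by
    induction m with
    | zero => simp
    | succ m ih => rw [← ih (by omega), h m (by omega)]; push_cast; rw [add_assoc]
  obtain ⟨m, hm, ht⟩ := c.exists_isTop_lt_period μ s
  intro k hk
  rwa [h0 k hk, ← h0 m (by omega)]

variable {c} in
/-- A long cycle contains two consecutive periods whose vertices have degree two and are visited
only once. -/
lemma exists_window [DecidableEq X] {V : Finset X} {D : Finset (X × (α × Bool))}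
    (h : c.InGraph V D) {r : ℕ} (hD : D.card + 2 ≤ 2 * (r + V.card))
    (hr : 12 * r * c.period ≤ c.length) :
    ∃ s₀ : ZMod c.length, ∀ m < 2 * c.period,
      (∀ t, c.vert t = c.vert (s₀ + m) → t = s₀ + m) ∧
      (D.filter fun d => d.1 = c.vert (s₀ + m)).card ≤ 2 := by
  classical
  obtain ⟨o, ho⟩ := exists_linearOrder_conj_le α
  have hb₁ := card_top_change_add_le h (μ := id) Function.injective_id ho
  -- Top for the dual order means bottom.
  have hb₂ := card_top_change_add_le h (μ := OrderDual.toDual) OrderDual.toDual.injective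
    (fun g u v huv => ho g v u huv)
  have hb₃ := card_branch_add_le h
  set B₁ := Finset.univ.filter fun s => ¬ (c.IsTop id s ↔ c.IsTop id (s + 1)) with hB₁
  set B₂ := Finset.univ.filter fun s =>
    ¬ (c.IsTop OrderDual.toDual s ↔ c.IsTop OrderDual.toDual (s + 1)) with hB₂
  set B₃ := Finset.univ.filter fun s => (∀ t, c.vert t = c.vert s → t = s) ∧
      3 ≤ (D.filter fun d => d.1 = c.vert s).card with hB₃
  -- Each of the three sets has at most 2r − 2 elements. Doubling 6r, for blocks of two periods,
  -- gives the constant 12.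
  have hB : (B₁ ∪ B₂ ∪ B₃).card < 6 * r := by
    have h1 := Finset.card_union_le (B₁ ∪ B₂) B₃
    have h2 := Finset.card_union_le B₁ B₂
    omega
  obtain ⟨k, hk, hw⟩ : ∃ k < 6 * r, ∀ m < 2 * c.period,
      ((2 * c.period * k + m : ℕ) : ZMod c.length) ∉ B₁ ∪ B₂ ∪ B₃ := by
    by_contra! hc
    choose! g hg hgB using hc
    have hlt (k) (hk : k < 6 * r) : 2 * c.period * k + g k < c.length := by
      have h1 := hg k hk
      have h2 : 2 * c.period * (k + 1) ≤ 2 * c.period * (6 * r) := Nat.mul_le_mul_left _ hk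
      have h3 : 2 * c.period * (6 * r) = 12 * r * c.period := by ring
      rw [mul_add] at h2
      omega
    have := Finset.card_le_card_of_injOn (s := Finset.range (6 * r)) (t := B₁ ∪ B₂ ∪ B₃)
      (fun k => ((2 * c.period * k + g k : ℕ) : ZMod c.length))
      (fun k hk => hgB k (by simpa using hk)) (by
        intro k hk k' hk' e
        simp only [Finset.coe_range, Set.mem_Iio] at hk hk'
        simp only [ZMod.natCast_eq_natCast_iff', Nat.mod_eq_of_lt (hlt k hk),
          Nat.mod_eq_of_lt (hlt k' hk')] at e
        have hp : 0 < 2 * c.period := by have := c.period_pos; omega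
        have e1 := congrArg (· / (2 * c.period)) e
        simpa [Nat.mul_add_div hp, Nat.div_eq_of_lt (hg k hk), Nat.div_eq_of_lt (hg k' hk')]
          using e1)
    rw [Finset.card_range] at this
    omega
  refine ⟨((2 * c.period * k : ℕ) : ZMod c.length), fun m hm => ?_⟩
  have hw' (m : ℕ) (hm : m < 2 * c.period) :
      ((2 * c.period * k : ℕ) : ZMod c.length) + m ∉ B₁ ∪ B₂ ∪ B₃ := by
    have := hw m hm
    rwa [Nat.cast_add] at this
  generalize ((2 * c.period * k : ℕ) : ZMod c.length) = s₀ at hw'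
  simp only [Finset.mem_union, not_or, hB₁, hB₂, hB₃, Finset.mem_filter, Finset.mem_univ,
    true_and, not_not] at hw'
  have ht := c.forall_isTop (by omega) (fun m hm => (hw' m hm).1.1) m hm.le
  have hb := c.forall_isTop (by omega) (fun m hm => (hw' m hm).1.2) m hm.le
  -- A rotation both largest and smallest over its vertex is the only one there.
  have hu (t) (e : c.vert t = c.vert (s₀ + m)) : t = s₀ + m :=
    c.ext_vert_rot _ _ e (le_antisymm (ht t e) (hb t e))
  have := (hw' m hm).2
  exact ⟨hu, by by_contra hc; exact this ⟨hu, by omega⟩⟩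

/-- At a vertex of degree two the immersed path `c'` uses both edges, so it has to follow `c`,
forwards or backwards according to `b`. -/
lemma lab_eq_of_window [DecidableEq X] {c c' : SchreierCycle α X}
    {V : Finset X} {D : Finset (X × (α × Bool))} (h : c.InGraph V D) (h' : c'.InGraph V D)
    {s : ZMod c.length} {t : ZMod c'.length} (hst : c'.vert t = c.vert s)
    {n : ℕ} (hs : ∀ m < n, (D.filter fun d => d.1 = c.vert (s + (m : ℕ))).card ≤ 2) :
    ∃ b, ∀ m < n, c'.vert (t + m * c'.dir b) = c.vert (s + m) ∧
      c'.out (t + m * c'.dir b) b = c.lab (s + m) := by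
  have key {s : ZMod c.length} {t : ZMod c'.length} (hst : c'.vert t = c.vert s)
      (hs : (D.filter fun d => d.1 = c.vert s).card ≤ 2) (b : Bool) :
      c'.out t b = c.lab s ∨ c'.out t (!b) = c.lab s := by
    classical
    by_contra! hc
    have hsub : ({(c.vert s, c'.out t b), (c.vert s, c'.out t !b), (c.vert s, c.lab s)} :
        Finset _) ⊆ D.filter fun d => d.1 = c.vert s := by
      intro d hd
      simp only [Finset.mem_insert, Finset.mem_singleton] at hd
      rw [Finset.mem_filter]
      rcases hd with rfl | rfl | rfl
      · exact ⟨hst ▸ h'.out_mem t b, rfl⟩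
      · exact ⟨hst ▸ h'.out_mem t _, rfl⟩
      · exact ⟨h.out_mem s true, rfl⟩
    have h1 := Finset.card_le_card hsub
    rw [Finset.card_eq_three.mpr ⟨_, _, _, ?_, ?_, ?_, rfl⟩] at h1
    · omega
    · simpa using c'.out_ne t b
    · simpa using hc.1
    · simpa using hc.2
  rcases Nat.eq_zero_or_pos n with rfl | hn
  · exact ⟨true, by simp⟩
  have h0 := hs 0 hn
  rw [Nat.cast_zero, add_zero] at h0
  obtain ⟨b, hb⟩ : ∃ b, c'.out t b = c.lab s := by
    rcases key hst h0 true with h | h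
    exacts [⟨_, h⟩, ⟨_, h⟩]
  refine ⟨b, fun m hm => ?_⟩
  induction m with
  | zero => simpa using ⟨hst, hb⟩
  | succ m ih =>
    obtain ⟨ih1, ih2⟩ := ih (by omega)
    have e1 : t + (m + 1 : ℕ) * c'.dir b = t + m * c'.dir b + c'.dir b := by push_cast; ring
    have e2 : s + ((m + 1 : ℕ) : ZMod c.length) = s + m + 1 := by push_cast; ring
    have hv : c'.vert (t + m * c'.dir b + c'.dir b) = c.vert (s + m + 1) := by
      rw [vert_add_dir, ih1, ih2, c.vert_succ]
    have h1 := hs (m + 1) hm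
    rw [e2] at h1
    rw [e1, e2]
    -- Otherwise the next edge of `c` would be the reverse of the one just traversed.
    refine ⟨hv, (key hv h1 b).resolve_right fun hc => ?_⟩
    rw [out_add_dir, ih2] at hc
    exact c.lab_succ_ne _ hc.symm

end SchreierCycle

end FreeGroup

/-! ### Commuting words and independent chains -/

namespace FreeGroup

lemma wordProd_reverse {α R : Type*} [AddCommGroupWithOne R] (f : R → α × Bool) (t : R) (n : ℕ) :
    wordProd (fun m => flipLetter (f (t - m - 1))) n =
      (wordProd (fun k => f (t - n + k)) n)⁻¹ := by
  induction n with
  | zero => simp [wordProd]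
  | succ n ih =>
    rw [wordProd, ih, add_comm n 1, wordProd_add, mul_inv_rev, letter_flipLetter]
    congr 2
    · simp [wordProd, sub_sub, add_comm]
    · refine wordProd_congr fun k _ => ?_
      congr 1
      push_cast
      abel

/-- The geometric edge which is traversed from `v` along the letter `x`. -/
def edgeOf {α X : Type*} [MulAction (FreeGroup α) X] (v : X) (x : α × Bool) : X × α :=
  if x.2 then (v, x.1) else (letter x • v, x.1)

section Edge

variable {α X : Type*} [MulAction (FreeGroup α) X]

lemma pathChain_letter (v : X) (x : α × Bool) :
    pathChain (letter x) v = Finsupp.single (edgeOf v x) (if x.2 then 1 else -1) := by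
  obtain ⟨a, b⟩ := x
  cases b
  · have h : letter (a, false) = (of a)⁻¹ := letter_flipLetter (a, true)
    rw [h, pathChain_inv, pathChain_of, ← h]
    simp [edgeOf]
  · exact pathChain_of a v

lemma edgeOf_eq_edgeOf {v w : X} {x y : α × Bool} (h : edgeOf w y = edgeOf v x) :
    w = v ∧ y = x ∨ letter y • w = v ∧ y = flipLetter x := by
  obtain ⟨a, b⟩ := x
  obtain ⟨a', b'⟩ := y
  have h1 : letter (a, false) = (letter (a, true))⁻¹ := letter_flipLetter (a, true)
  cases b <;> cases b' <;> simp only [edgeOf, if_true, Bool.false_eq_true, if_false,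
    Prod.mk.injEq] at h <;> obtain ⟨h, rfl⟩ := h
  · exact Or.inl ⟨smul_left_cancel _ h, rfl⟩
  · exact Or.inr ⟨by rw [h, h1, smul_inv_smul], rfl⟩
  · exact Or.inr ⟨h, rfl⟩
  · exact Or.inl ⟨h, rfl⟩

end Edge

namespace SchreierCycle

variable {α X : Type*} [MulAction (FreeGroup α) X]

lemma rot_add_natCast (c : SchreierCycle α X) (s : ZMod c.length) (n : ℕ) :
    c.rot (s + n) = wordProd (fun k => c.lab (s + k)) n * c.rot s *
      (wordProd (fun k => c.lab (s + k)) n)⁻¹ := by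
  induction n with
  | zero => simp [wordProd]
  | succ n ih =>
    rw [Nat.cast_succ, ← add_assoc, c.rot_succ, ih, wordProd]
    group

/-- If a cycle of smaller period visits a window of two periods of `c`, then some rotations of the
two words commute. -/
lemma exists_commute_rot [DecidableEq X] {c c' : SchreierCycle α X}
    {V : Finset X} {D : Finset (X × (α × Bool))} (h : c.InGraph V D) (h' : c'.InGraph V D)
    (hp : c'.period ≤ c.period)
    {s : ZMod c.length} {t : ZMod c'.length} (hst : c'.vert t = c.vert s)
    (hs : ∀ m < 2 * c.period, (D.filter fun d => d.1 = c.vert (s + (m : ℕ))).card ≤ 2) :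
    ∃ t', Commute (c.rot s) (c'.rot t') := by
  obtain ⟨b, hb⟩ := lab_eq_of_window h h' hst hs
  have hper (m : ℕ) : c'.out (t + (m + c'.period : ℕ) * c'.dir b) b =
      c'.out (t + m * c'.dir b) b := by
    cases b
    · simp only [out, dir, Bool.false_eq_true, if_false]
      rw [← c'.lab_add_period (t + (m + c'.period : ℕ) * (-1) - 1)]
      congr 2
      push_cast
      ring
    · simp only [out, dir, if_true]
      rw [← c'.lab_add_period (t + m * 1)]
      congr 1
      push_cast
      ring
  -- After reducing `m` modulo `c.period`, both positions lie below `2 * c.period`, where the labels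
  -- agree with those of `c'`. This is why the window needs two periods.
  have hlab (m : ℕ) : c.lab (s + (m + c'.period : ℕ)) = c.lab (s + m) := by
    have hmod (k : ℕ) : c.lab (s + (m + k : ℕ)) = c.lab (s + (m % c.period + k : ℕ)) := by
      rw [← c.lab_add_mul_period (s + (m % c.period + k : ℕ)) (m / c.period)]
      congr 1
      nth_rw 1 [← Nat.mod_add_div m c.period]
      push_cast
      ring
    have h0 := hmod 0
    simp only [add_zero] at h0
    have hm := Nat.mod_lt m c.period_pos
    rw [hmod, h0, ← (hb _ _).2, ← (hb _ _).2, hper] <;> omega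
  have h1 : c.rot (s + c'.period) = c.rot s :=
    c.rot_congr fun k => by
      rw [← hlab k]
      congr 1
      push_cast
      ring
  rw [rot_add_natCast] at h1
  have h2 : Commute (c.rot s) (wordProd (fun k => c.lab (s + k)) c'.period) :=
    (mul_inv_eq_iff_eq_mul.mp h1).symm
  have h3 : wordProd (fun k => c.lab (s + k)) c'.period =
      wordProd (fun m : ℕ => c'.out (t + m * c'.dir b) b) c'.period :=
    wordProd_congr fun k hk => (hb k (by omega)).2.symm
  rw [h3] at h2
  -- A window followed backwards spells the inverse of a rotation of the word of `c'`.
  cases b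
  · refine ⟨t - c'.period, ?_⟩
    have := wordProd_reverse c'.lab t c'.period
    simp only [out, dir, Bool.false_eq_true, if_false, mul_neg, mul_one, ← sub_eq_add_neg,
      this] at h2
    rw [c'.rot_eq]
    exact Commute.inv_right_iff.mp h2
  · refine ⟨t, ?_⟩
    simp only [out, dir, if_true, mul_one] at h2
    rwa [c'.rot_eq]

/-- The cellular chain of a cycle. -/
noncomputable def chain (c : SchreierCycle α X) : X × α →₀ ℚ :=
  ∑ s, pathChain (letter (c.lab s)) (c.vert s)

/-- A second traversal of the edge would start at this vertex, which is visited once, or end there,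
which forces backtracking. So nothing cancels. -/
lemma chain_apply_ne_zero (c : SchreierCycle α X) {s : ZMod c.length}
    (hs : ∀ t, c.vert t = c.vert s → t = s) : c.chain (edgeOf (c.vert s) (c.lab s)) ≠ 0 := by
  classical
  rw [chain, Finsupp.finsetSum_apply, Finset.sum_eq_single s]
  · rw [pathChain_letter, Finsupp.single_eq_same]
    split_ifs <;> norm_num
  · intro t _ hts
    rw [pathChain_letter, Finsupp.single_apply, if_neg]
    intro e
    rcases edgeOf_eq_edgeOf e with ⟨e, -⟩ | ⟨e, e'⟩
    · exact hts (hs t e)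
    · rw [← c.vert_succ] at e
      have := hs _ e
      rw [← this] at e'
      exact c.lab_succ_ne t (by rw [e', flipLetter_flipLetter])
  · simp

lemma chain_apply_eq_zero (c : SchreierCycle α X) {v : X} (hv : ∀ t, c.vert t ≠ v)
    (x : α × Bool) : c.chain (edgeOf v x) = 0 := by
  classical
  rw [chain, Finsupp.finsetSum_apply]
  refine Finset.sum_eq_zero fun t _ => ?_
  rw [pathChain_letter, Finsupp.single_apply, if_neg]
  intro e
  rcases edgeOf_eq_edgeOf e with ⟨e, -⟩ | ⟨e, -⟩
  · exact hv t e
  · rw [← c.vert_succ] at e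
    exact hv _ e

/-- The family is triangular: in a relation, take a cycle of maximal period with nonzero coefficient
and evaluate at its private edge. -/
lemma linearIndependent_chain {ι : Type*} [Fintype ι] (c : ι → SchreierCycle α X)
    (s : ∀ i, ZMod (c i).length) (hs : ∀ i t, (c i).vert t = (c i).vert (s i) → t = s i)
    (hc : ∀ i j, i ≠ j → (c j).period ≤ (c i).period → ∀ t, (c j).vert t ≠ (c i).vert (s i)) :
    LinearIndependent ℚ fun i => (c i).chain := by
  classical
  rw [Fintype.linearIndependent_iff]
  intro a ha
  by_contra! hne
  obtain ⟨i, hi, hmax⟩ := Finset.exists_max_image (Finset.univ.filter fun i => a i ≠ 0)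
    (fun i => (c i).period) (by
      obtain ⟨i, hi⟩ := hne
      exact ⟨i, by simpa using hi⟩)
  simp only [Finset.mem_filter, Finset.mem_univ, true_and] at hi hmax
  have h := DFunLike.congr_fun ha (edgeOf ((c i).vert (s i)) ((c i).lab (s i)))
  rw [Finsupp.finsetSum_apply, Finset.sum_eq_single i] at h
  · simp only [Finsupp.smul_apply, smul_eq_mul, Finsupp.coe_zero, Pi.zero_apply,
      mul_eq_zero] at h
    exact h.elim hi ((c i).chain_apply_ne_zero (hs i))
  · intro j _ hji
    by_cases hj : a j = 0
    · simp [hj]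
    · simp [(c j).chain_apply_eq_zero (hc i j hji.symm (hmax j hj))]
  · simp

theorem card_le_of_long {x₀ : X} [MulAction.IsPretransitive (FreeGroup α) X]
    {S : Finset (FreeGroup α)}
    (hS : Subgroup.closure (S : Set (FreeGroup α)) = MulAction.stabilizer (FreeGroup α) x₀)
    {ι : Type*} [Fintype ι] (c : ι → SchreierCycle α X)
    (hlen : ∀ i, 12 * S.card * (c i).period ≤ (c i).length)
    (hloop : ∀ i, ∃ g : FreeGroup α, g • x₀ = x₀ ∧ pathChain g x₀ = (c i).chain)
    (hcomm : ∀ i j, i ≠ j → ∀ s t, ¬ Commute ((c i).rot s) ((c j).rot t)) :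
    Fintype.card ι ≤ S.card := by
  classical
  rcases isEmpty_or_nonempty ι with hι | ⟨⟨i₀⟩⟩
  · simp
  let V : Finset X := Finset.univ.biUnion fun i => Finset.univ.image (c i).vert
  let D : Finset (X × (α × Bool)) := Finset.univ.biUnion fun i =>
    Finset.univ.image fun q : ZMod (c i).length × Bool => ((c i).vert q.1, (c i).out q.1 q.2)
  have hV (v : X) : v ∈ V ↔ ∃ i s, (c i).vert s = v := by simp [V]
  have hD (d) : d ∈ D ↔ ∃ i s b, ((c i).vert s, (c i).out s b) = d := by simp [D]
  have hg (i : ι) : (c i).InGraph V D :=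
    { fst_mem := by
        intro d hd
        obtain ⟨j, s, b, rfl⟩ := (hD d).mp hd
        exact (hV _).mpr ⟨j, s, rfl⟩
      two_le := by
        intro v hv
        obtain ⟨j, s, rfl⟩ := (hV v).mp hv
        refine Finset.one_lt_card.mpr
          ⟨((c j).vert s, (c j).out s true), ?_, ((c j).vert s, (c j).out s false), ?_, ?_⟩
        · exact Finset.mem_filter.mpr ⟨(hD _).mpr ⟨j, s, _, rfl⟩, rfl⟩
        · exact Finset.mem_filter.mpr ⟨(hD _).mpr ⟨j, s, _, rfl⟩, rfl⟩
        · simpa using (c j).out_ne s true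
      vert_mem := fun s => (hV _).mpr ⟨i, s, rfl⟩
      out_mem := fun s b => (hD _).mpr ⟨i, s, b, rfl⟩ }
  have hcard := card_directedEdges_add_two_le hS
    ⟨(c i₀).vert 0, (hV _).mpr ⟨i₀, 0, rfl⟩⟩ (hg i₀).fst_mem (by
      intro d hd
      obtain ⟨j, s, b, rfl⟩ := (hD d).mp hd
      exact (hD _).mpr ⟨j, s + (c j).dir b, !b, by rw [vert_add_dir, out_add_dir]⟩)
  choose s hs using fun i => exists_window (hg i) hcard (hlen i)
  refine card_le_of_linearIndependent_pathChain hS (fun i => (c i).chain)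
    (linearIndependent_chain c s (fun i t ht => ?_) fun i j hij hp t ht => ?_) hloop
  · have := (hs i 0 (by have := (c i).period_pos; omega)).1
    simp only [Nat.cast_zero, add_zero] at this
    exact this t ht
  · obtain ⟨t', ht'⟩ := exists_commute_rot (hg i) (hg j) hp ht fun m hm => (hs i m hm).2
    exact hcomm i j hij _ _ ht'

end SchreierCycle

end FreeGroup

/-! ### Maximal cyclic subgroups of free groups -/

section MaximalCyclic

variable {G H : Type*} [Group G] [Group H]

/-- A commutative free group is cyclic. -/
lemma IsFreeGroup.isCyclic_of_isMulCommutative [IsFreeGroup G] [IsMulCommutative G] :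
    IsCyclic G := by
  let e := IsFreeGroup.toFreeGroup G
  have hsub : Subsingleton (IsFreeGroup.Generators G) := by
    classical
    refine ⟨fun a b => ?_⟩
    have h1 : FreeGroup.of a * FreeGroup.of b = FreeGroup.of b * FreeGroup.of a := by
      apply e.symm.injective
      rw [map_mul, map_mul, mul_comm']
    have h2 := FreeGroup.reduce.sound (L₁ := [(a, true), (b, true)])
      (L₂ := [(b, true), (a, true)]) h1
    have hr (x y : IsFreeGroup.Generators G) :
        FreeGroup.IsReduced [(x, true), (y, true)] := by simp [FreeGroup.IsReduced]
    rw [(hr _ _).reduce_eq, (hr _ _).reduce_eq] at h2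
    simp only [List.cons.injEq, Prod.mk.injEq] at h2
    exact h2.1.1
  have : IsCyclic (FreeGroup (IsFreeGroup.Generators G)) := by
    rcases isEmpty_or_nonempty (IsFreeGroup.Generators G) with h | ⟨⟨a⟩⟩
    · infer_instance
    · have := uniqueOfSubsingleton a
      infer_instance
  exact isCyclic_of_surjective e.symm e.symm.surjective

lemma Subgroup.isCyclic_map_mulEquiv (e : G ≃* H) (K : Subgroup G) (hK : IsCyclic K) :
    IsCyclic (K.map e.toMonoidHom) :=
  isCyclic_of_surjective (e.subgroupMap K) (e.subgroupMap K).surjective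

lemma IsMaximalCyclic.map {M : Subgroup G} (h : IsMaximalCyclic M) (e : G ≃* H) :
    IsMaximalCyclic (M.map e.toMonoidHom) := by
  refine ⟨Subgroup.isCyclic_map_mulEquiv e M h.1, fun K hK hle => ?_⟩
  have hK' : IsCyclic (K.comap e.toMonoidHom) := by
    have := Subgroup.isCyclic_map_mulEquiv e.symm K hK
    rwa [show K.map e.symm.toMonoidHom = K.comap e.toMonoidHom from
      (Subgroup.comap_equiv_eq_map_symm e K).symm] at this
  have h1 : K.comap e.toMonoidHom ≤ M := h.2 hK' (Subgroup.map_le_iff_le_comap.mp hle)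
  intro k hk
  refine ⟨e.symm k, h1 ?_, e.apply_symm_apply k⟩
  simpa using hk

/-- In a free group, a maximal cyclic subgroup contains the centralizer of its generator. -/
lemma IsMaximalCyclic.mem_of_commute [IsFreeGroup G] {x g : G}
    (h : IsMaximalCyclic (Subgroup.zpowers x)) (hg : Commute g x) : g ∈ Subgroup.zpowers x := by
  let K := Subgroup.closure {x, g}
  have hc : IsMulCommutative K := Subgroup.isMulCommutative_closure (by
    rintro a (rfl | rfl) b (rfl | rfl)
    exacts [rfl, hg.symm.eq, hg.eq, rfl])
  have hK : IsCyclic K := IsFreeGroup.isCyclic_of_isMulCommutative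
  have hle : Subgroup.zpowers x ≤ K := by
    rw [Subgroup.zpowers_le]
    exact Subgroup.subset_closure (by simp)
  exact h.2 hK hle (Subgroup.subset_closure (by simp))

lemma IsMaximalCyclic.zpowers_eq_of_commute [IsFreeGroup G] {x y : G}
    (hx : IsMaximalCyclic (Subgroup.zpowers x)) (hy : IsMaximalCyclic (Subgroup.zpowers y))
    (h : Commute x y) : Subgroup.zpowers x = Subgroup.zpowers y :=
  le_antisymm (Subgroup.zpowers_le.mpr (hy.mem_of_commute h))
    (Subgroup.zpowers_le.mpr (hx.mem_of_commute h.symm))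

lemma map_conj_zpowers (g x : G) :
    (Subgroup.zpowers x).map (MulAut.conj g).toMonoidHom = Subgroup.zpowers (g * x * g⁻¹) := by
  rw [MonoidHom.map_zpowers]
  rfl

lemma IsMaximalCyclic.conj {x : G} (h : IsMaximalCyclic (Subgroup.zpowers x)) (g : G) :
    IsMaximalCyclic (Subgroup.zpowers (g * x * g⁻¹)) := by
  rw [← map_conj_zpowers]
  exact h.map _

/-- The exponents in question form a subgroup aℤ of index |a|. The default value 0 for infinite
index fits, since 0 divides only 0. -/
lemma zpow_mem_iff_relIndex_dvd (A : Subgroup G) (x : G)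
    (k : ℤ) : x ^ k ∈ A ↔ ((A.relIndex (Subgroup.zpowers x) : ℕ) : ℤ) ∣ k := by
  let K : AddSubgroup ℤ := Subgroup.toAddSubgroup' (A.comap (zpowersHom G x))
  obtain ⟨a, ha⟩ := Int.subgroup_cyclic K
  rw [← AddSubgroup.zmultiples_eq_closure] at ha
  have h1 : K.index = A.relIndex (Subgroup.zpowers x) := Subgroup.index_comap A (zpowersHom G x)
  rw [ha, Int.index_zmultiples] at h1
  have h2 : x ^ k ∈ A ↔ k ∈ K := Iff.rfl
  rw [h2, ha, ← h1, Int.mem_zmultiples_iff, Int.natAbs_dvd]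

lemma subgroupConjClass_map_conj (M : Subgroup G) (g : G) :
    subgroupConjClass (M.map (MulAut.conj g).toMonoidHom) = subgroupConjClass M := by
  ext N
  constructor
  · rintro ⟨a, rfl⟩
    refine ⟨a * g, ?_⟩
    rw [Subgroup.map_map]
    congr 1
    ext x
    simp
  · rintro ⟨a, rfl⟩
    refine ⟨a * g⁻¹, ?_⟩
    rw [Subgroup.map_map]
    congr 1
    ext x
    simp [mul_assoc]

end MaximalCyclic

/-! ### From cyclically reduced words to cycles -/

namespace FreeGroup

variable {α X : Type*} [MulAction (FreeGroup α) X]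

lemma wordProd_getD_reverse (d : α × Bool) (L : List (α × Bool)) :
    wordProd (fun t => L.reverse.getD t d) L.length = mk L := by
  induction L with
  | nil => rfl
  | cons x L ih =>
    have h : (mk (x :: L) : FreeGroup α) = letter x * mk L := by simp [letter]
    rw [h, ← ih, List.length_cons, wordProd]
    congr 1
    · simp [List.getD_eq_getElem?_getD]
    · refine wordProd_congr fun k hk => ?_
      simp [List.getD_eq_getElem?_getD, List.getElem?_append, hk]

lemma norm_wordProd [DecidableEq α] {f : ℕ → α × Bool} (hf : ∀ t, f (t + 1) ≠ flipLetter (f t))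
    (n : ℕ) : (wordProd f n).norm = n := by
  let w : ℕ → List (α × Bool) := fun n => Nat.rec [] (fun k L => f k :: L) n
  have h1 (n : ℕ) : mk (w n) = wordProd f n := by
    induction n with
    | zero => rfl
    | succ n ih =>
      have h : (mk (w (n + 1)) : FreeGroup α) = letter (f n) * mk (w n) := by simp [letter, w]
      rw [h, ih, wordProd]
  have h2 (n : ℕ) : IsReduced (w n) := by
    induction n with
    | zero => simp [w]
    | succ n ih =>
      cases n with
      | zero => simp [w]
      | succ n =>
        change IsReduced (f (n + 1) :: f n :: w n)
        have ih' : IsReduced (f n :: w n) := ih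
        rw [IsReduced, List.isChain_cons_cons]
        refine ⟨fun e => ?_, ih'⟩
        by_contra hne
        exact hf n (Prod.ext e (by simp [flipLetter, Bool.eq_not_iff, hne]))
  have h3 (n : ℕ) : (w n).length = n := by
    induction n with
    | zero => rfl
    | succ n ih => simpa [w] using ih
  rw [← h1, norm, toWord_mk, (h2 n).reduce_eq, h3]

lemma pathChain_wordProd (f : ℕ → α × Bool) (y : X) (n : ℕ) :
    pathChain (wordProd f n) y =
      ∑ t ∈ Finset.range n, pathChain (letter (f t)) (wordProd f t • y) := by
  induction n with
  | zero => simp [wordProd]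
  | succ n ih => rw [Finset.sum_range_succ, wordProd, pathChain_mul, ih]

lemma IsCyclicallyReduced.exists_periodic {U : List (α × Bool)} (hU : IsCyclicallyReduced U)
    (hne : U ≠ []) : ∃ f : ℕ → α × Bool, (∀ t, f (t + U.length) = f t) ∧
      (∀ t, f (t + 1) ≠ flipLetter (f t)) ∧ wordProd f U.length = mk U := by
  obtain ⟨d, hd⟩ := List.exists_mem_of_ne_nil U hne
  have hp : 0 < U.length := List.length_pos_iff.mpr hne
  refine ⟨fun t => U.reverse.getD (t % U.length) d, fun t => by simp, fun t => ?_, ?_⟩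
  · have hlt := Nat.mod_lt t hp
    have key (x y : α × Bool) (h : y.1 = x.1 → y.2 = x.2) : y ≠ flipLetter x := by
      rintro rfl
      simpa [flipLetter] using h rfl
    refine key _ _ fun e => ?_
    have hchain := List.isChain_iff_getElem.mp hU.1
    have hget (i : ℕ) (hi : i < U.length) :
        U.reverse.getD i d = U[U.length - 1 - i] := by
      rw [List.getD_eq_getElem _ _ (by simpa using hi), List.getElem_reverse]
    -- At the seam between two copies of the word, cyclic reducedness is needed; elsewhere
    -- reducedness suffices.
    by_cases hlast : t % U.length + 1 = U.length
    · have h0 : (t + 1) % U.length = 0 := by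
        rw [← Nat.mod_add_mod, hlast, Nat.mod_self]
      simp only [h0] at e ⊢
      rw [hget _ hp, hget _ hlt] at e ⊢
      refine hU.2 _ ?_ _ ?_ e
      · simp [List.getLast?_eq_getElem?, hp]
      · simp [List.head?_eq_getElem?, show U.length - 1 - t % U.length = 0 by omega, hp]
    · have h0 : (t + 1) % U.length = t % U.length + 1 := by
        rw [← Nat.mod_add_mod, Nat.mod_eq_of_lt (by omega)]
      simp only [h0] at e ⊢
      rw [hget _ (by omega), hget _ hlt] at e ⊢
      have := hchain (U.length - 1 - (t % U.length + 1)) (by omega)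
      simp only [show U.length - 1 - (t % U.length + 1) + 1 = U.length - 1 - t % U.length by omega]
        at this
      exact this e
  · rw [← wordProd_getD_reverse d]
    exact wordProd_congr fun k hk => by simp only [Nat.mod_eq_of_lt hk]

lemma apply_val_add_natCast {β : Type*} {N : ℕ} [NeZero N] (φ : ℕ → β)
    (hφ : ∀ t, φ (t + N) = φ t) (s : ZMod N) (k : ℕ) : φ (s + k).val = φ (s.val + k) := by
  rw [ZMod.val_add, ZMod.val_natCast, Nat.add_mod_mod]
  exact Function.Periodic.map_mod_nat hφ _

/-- The cycle read off from a cyclically reduced word at a point with finite orbit. -/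
lemma exists_schreierCycle {U : List (α × Bool)} (hU : IsCyclicallyReduced U) (hne : U ≠ [])
    (hcent : ∀ g, Commute g (mk U) → ∃ k : ℤ, g = mk U ^ k) {y : X} {n : ℕ} (hn : 0 < n)
    (hy : ∀ k : ℤ, mk U ^ k • y = y ↔ (n : ℤ) ∣ k) :
    ∃ c : SchreierCycle α X, c.length = n * c.period ∧ c.chain = pathChain (mk U ^ n) y ∧
      ∀ s, ∃ g, c.rot s = g * mk U * g⁻¹ := by
  classical
  obtain ⟨f, hper, hred, hprod⟩ := hU.exists_periodic hne
  set u : FreeGroup α := mk U with hu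
  set p := U.length with hp
  have hp0 : 0 < p := List.length_pos_iff.mpr hne
  have : NeZero (n * p) := ⟨(Nat.mul_pos hn hp0).ne'⟩
  have hperk (k t : ℕ) : f (t + k * p) = f t := by
    induction k with
    | zero => simp
    | succ k ih => rw [add_mul, one_mul, ← add_assoc, hper, ih]
  have hP (t : ℕ) : wordProd f (t + p) = wordProd f t * u := by
    rw [add_comm, wordProd_add, hprod]
    congr 1
    exact wordProd_congr fun k _ => by rw [add_comm, hper]
  have hPk (k t : ℕ) : wordProd f (t + k * p) = wordProd f t * u ^ k := by
    induction k with
    | zero => simp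
    | succ k ih => rw [add_mul, one_mul, ← add_assoc, hP, ih, pow_succ, mul_assoc]
  -- The infinite word is reduced, so the norm of a prefix recovers its length.
  have hmul_add {x z m : ℕ} (h : wordProd f x = wordProd f z * u ^ m) : x = z + m * p := by
    rw [← hPk] at h
    rw [← norm_wordProd hred x, h, norm_wordProd hred]
  have hyn : u ^ n • y = y := by simpa using (hy n).mpr dvd_rfl
  have hv (t : ℕ) : wordProd f (t + n * p) • y = wordProd f t • y := by
    rw [hPk, mul_smul, hyn]
  have hr (t : ℕ) : wordProd f (t + n * p) * u * (wordProd f (t + n * p))⁻¹ =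
      wordProd f t * u * (wordProd f t)⁻¹ := by
    rw [hPk]; group
  let c : SchreierCycle α X :=
    { length := n * p
      period := p
      length_pos := Nat.mul_pos hn hp0
      period_pos := hp0
      vert := fun s => wordProd f s.val • y
      lab := fun s => f s.val
      rot := fun s => wordProd f s.val * u * (wordProd f s.val)⁻¹
      vert_succ := fun s => by
        have := apply_val_add_natCast (fun t => wordProd f t • y) hv s 1
        rw [Nat.cast_one] at this
        rw [this, wordProd, mul_smul]
      rot_succ := fun s => by
        have := apply_val_add_natCast (fun t => wordProd f t * u * (wordProd f t)⁻¹) hr s 1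
        rw [Nat.cast_one] at this
        rw [this, wordProd]
        group
      lab_succ_ne := fun s => by
        have := apply_val_add_natCast f (hperk n) s 1
        rw [Nat.cast_one] at this
        rw [this]
        exact hred _
      lab_add_period := fun s => by rw [apply_val_add_natCast f (hperk n), hper]
      rot_eq := fun s => by
        have : (fun k : ℕ => f (s + k).val) = fun k => f (s.val + k) :=
          funext fun k => apply_val_add_natCast f (hperk n) s k
        rw [this, mul_inv_eq_iff_eq_mul, ← wordProd_add, hP]
      -- Equal rotations make the two prefixes differ by an element of the centralizer, a power `u ^
      -- k`. Equal vertices give `n ∣ k`, so the positions differ by a multiple of `n * p`.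
      ext_vert_rot := fun s t hvert hrot => by
        have h1 : Commute ((wordProd f t.val)⁻¹ * wordProd f s.val) u := by
          rw [mul_inv_eq_iff_eq_mul] at hrot
          rw [Commute, SemiconjBy, mul_assoc, hrot]
          group
        obtain ⟨k, hk⟩ := hcent _ h1
        have hk' : wordProd f s.val = wordProd f t.val * u ^ k := by
          rw [← hk, mul_inv_cancel_left]
        have h2 : u ^ k • y = y := by
          have hvert' : wordProd f s.val • y = wordProd f t.val • y := hvert
          rw [hk', mul_smul] at hvert'
          exact smul_left_cancel _ hvert'
        obtain ⟨j, rfl⟩ := (hy k).mp h2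
        have hs := ZMod.val_lt s
        have ht := ZMod.val_lt t
        have hzero {a b i : ℕ} (ha : a < n * p) (h : a = b + n * i * p) : a = b := by
          rcases Nat.eq_zero_or_pos i with rfl | hi
          · simpa using h
          · have : n * p ≤ n * i * p := by
              rw [mul_right_comm]
              exact Nat.le_mul_of_pos_right _ hi
            omega
        apply ZMod.val_injective
        obtain ⟨i, rfl | rfl⟩ := Int.eq_nat_or_neg j
        · rw [← Nat.cast_mul, zpow_natCast] at hk'
          exact hzero hs (hmul_add hk')
        · rw [mul_neg, ← Nat.cast_mul, zpow_neg, zpow_natCast, eq_mul_inv_iff_mul_eq] at hk'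
          exact (hzero ht (hmul_add hk'.symm)).symm }
  refine ⟨c, rfl, ?_, fun s => ⟨_, rfl⟩⟩
  have h1 := hPk n 0
  rw [zero_add, wordProd, one_mul] at h1
  rw [← h1, pathChain_wordProd]
  refine Finset.sum_bij' (fun s _ => ZMod.val s) (fun t _ => (t : ZMod (n * p))) ?_ ?_ ?_ ?_ ?_
  · intro s _
    exact Finset.mem_range.mpr (ZMod.val_lt s)
  · simp
  · intro s _
    exact ZMod.natCast_zmod_val s
  · intro t ht
    exact ZMod.val_cast_of_lt (Finset.mem_range.mp ht)
  · intro s _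
    rfl

end FreeGroup

/-! ### The cycles of maximal cyclic subgroups and the final count -/

namespace FreeGroup

variable {α : Type*}

/-- The cycle of a maximal cyclic subgroup in the Schreier graph of `A`. -/
lemma exists_schreierCycle_of_isMaximalCyclic (A : Subgroup (FreeGroup α)) {m : FreeGroup α}
    (hm : IsMaximalCyclic (Subgroup.zpowers m)) (hm1 : m ≠ 1)
    (hfin : A.relIndex (Subgroup.zpowers m) ≠ 0) :
    ∃ c : SchreierCycle α (FreeGroup α ⧸ A),
      c.length = A.relIndex (Subgroup.zpowers m) * c.period ∧
      (∃ g : FreeGroup α, g • ((1 : FreeGroup α) : FreeGroup α ⧸ A) = (1 : FreeGroup α) ∧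
        pathChain g ((1 : FreeGroup α) : FreeGroup α ⧸ A) = c.chain) ∧
      ∀ s, ∃ g, c.rot s = g * m * g⁻¹ := by
  classical
  set n := A.relIndex (Subgroup.zpowers m) with hn
  set x₀ : FreeGroup α ⧸ A := ((1 : FreeGroup α) : FreeGroup α ⧸ A) with hx₀
  have hmem (g : FreeGroup α) : g • x₀ = x₀ ↔ g ∈ A := by
    rw [hx₀, ← MulAction.mem_stabilizer_iff]
    simp
  let U := reduceCyclically m.toWord
  let g : FreeGroup α := mk (reduceCyclically.conjugator m.toWord)
  have hU : IsCyclicallyReduced U := reduceCyclically.isCyclicallyReduced isReduced_toWord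
  have hconj : g * mk U * g⁻¹ = m := by
    rw [inv_mk, mul_mk, mul_mk, reduceCyclically.conj_conjugator_reduceCyclically, mk_toWord]
  have hu : mk U = g⁻¹ * m * g⁻¹⁻¹ := by rw [← hconj]; group
  have hne : U ≠ [] := by
    intro h
    rw [h] at hconj
    apply hm1
    rw [← hconj, ← one_eq_mk]
    simp
  have hmax : IsMaximalCyclic (Subgroup.zpowers (mk U)) := by
    rw [hu]
    exact hm.conj g⁻¹
  have hpow (k : ℤ) : mk U ^ k = g⁻¹ * m ^ k * g := by
    rw [hu, conj_zpow, inv_inv]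
  have hy (k : ℤ) : mk U ^ k • (g⁻¹ • x₀) = g⁻¹ • x₀ ↔ (n : ℤ) ∣ k := by
    rw [← zpow_mem_iff_relIndex_dvd, ← hmem, hpow, mul_smul, smul_inv_smul, mul_smul,
      smul_left_cancel_iff]
  obtain ⟨c, hlen, hchain, hrot⟩ := exists_schreierCycle hU hne
    (fun h hh => by
      obtain ⟨k, hk⟩ := Subgroup.mem_zpowers_iff.mp (hmax.mem_of_commute hh)
      exact ⟨k, hk.symm⟩) (Nat.pos_of_ne_zero hfin) hy
  have hyn : mk U ^ n • (g⁻¹ • x₀) = g⁻¹ • x₀ := by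
    simpa using (hy n).mpr dvd_rfl
  -- The cycle is based at `g⁻¹ • x₀`; the paths joining it to `x₀` cancel in the chain.
  refine ⟨c, hlen, ⟨g * (mk U ^ n * g⁻¹), ?_, ?_⟩, fun s => ?_⟩
  · rw [mul_smul, mul_smul, hyn, smul_inv_smul]
  · rw [pathChain_mul, pathChain_mul, mul_smul, hyn, hchain, pathChain_inv]
    abel
  · obtain ⟨a, ha⟩ := hrot s
    refine ⟨a * g⁻¹, ?_⟩
    rw [ha, hu]
    group

theorem card_le_of_isMaximalCyclic [Nonempty α] {A : Subgroup (FreeGroup α)}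
    {S : Finset (FreeGroup α)} (hS : Subgroup.closure (S : Set (FreeGroup α)) = A)
    {ι : Type*} [Fintype ι] (M : ι → Subgroup (FreeGroup α)) (hM : ∀ i, IsMaximalCyclic (M i))
    (hfin : ∀ i, A.relIndex (M i) ≠ 0) (hlong : ∀ i, 12 * S.card ≤ A.relIndex (M i))
    (hconj : ∀ i j, i ≠ j → ∀ g, (M i).map (MulAut.conj g).toMonoidHom ≠ M j) :
    Fintype.card ι ≤ S.card := by
  have hgen (i : ι) : ∃ m, Subgroup.zpowers m = M i :=
    ((M i).isCyclic_iff_exists_zpowers_eq_top).mp (hM i).1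
  choose m hm using hgen
  have hm1 (i : ι) : m i ≠ 1 := by
    intro h
    obtain ⟨a⟩ := ‹Nonempty α›
    have h1 := hM i
    rw [← hm i] at h1
    -- The trivial subgroup is not maximal cyclic, since everything commutes with 1.
    have h2 := h1.mem_of_commute (g := of a) (by rw [h]; exact Commute.one_right _)
    rw [h, Subgroup.zpowers_one_eq_bot, Subgroup.mem_bot] at h2
    exact of_ne_one a h2
  have hmax (i : ι) : IsMaximalCyclic (Subgroup.zpowers (m i)) := (hm i).symm ▸ hM i
  choose c hlen hloop hrot using fun i =>
    exists_schreierCycle_of_isMaximalCyclic A (hmax i) (hm1 i) ((hm i).symm ▸ hfin i)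
  refine SchreierCycle.card_le_of_long (x₀ := ((1 : FreeGroup α) : FreeGroup α ⧸ A)) ?_ c
    (fun i => ?_) hloop fun i j hij s t hst => ?_
  · rw [hS]
    simp
  · rw [hlen, hm]
    exact Nat.mul_le_mul_right _ (hlong i)
  · obtain ⟨a, ha⟩ := hrot i s
    obtain ⟨b, hb⟩ := hrot j t
    rw [ha, hb] at hst
    have h1 := ((hmax i).conj a).zpowers_eq_of_commute ((hmax j).conj b) hst
    refine hconj i j hij (b⁻¹ * a) ?_
    rw [← hm i, ← hm j, map_conj_zpowers]
    have h2 := congrArg (Subgroup.map (MulAut.conj b⁻¹).toMonoidHom) h1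
    rw [map_conj_zpowers, map_conj_zpowers] at h2
    convert h2 using 2 <;> group

end FreeGroup

theorem mainTheorem5 {F : Type*} [Group F] [IsFreeGroup F] [Nontrivial F]
    (A : Subgroup F) [Group.FG A] :
    (longMaximalCyclicClasses A).encard ≤ (Group.rank A : ℕ∞) := by
  classical
  by_contra! hlt
  -- The set of classes is not known to be finite, so exactly `Group.rank A + 1` of them are
  -- selected.
  obtain ⟨C, hC, hcard⟩ := Set.exists_subset_encard_eq (Order.add_one_le_of_lt hlt)
  have hCfin : C.Finite := Set.finite_of_encard_eq_coe (k := Group.rank A + 1) (by simpa using hcard)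
  have := hCfin.fintype
  have hCcard : Fintype.card C = Group.rank A + 1 := by
    rw [← Nat.card_eq_fintype_card, Nat.card_coe_set_eq, Set.ncard, hcard]
    rfl
  choose M hM hfin hlong hclass using fun c : C => hC c.2
  simp only [Subgroup.inf_relIndex_right] at hfin hlong
  let e := IsFreeGroup.toFreeGroup F
  have hne : Nonempty (IsFreeGroup.Generators F) := by
    by_contra hempty
    rw [not_nonempty_iff] at hempty
    have := e.toEquiv.subsingleton
    exact not_subsingleton F this
  obtain ⟨S, hScard, hS⟩ := Group.rank_spec A
  let f : A →* FreeGroup (IsFreeGroup.Generators F) := e.toMonoidHom.comp A.subtype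
  have hf : Function.Injective f := e.injective.comp Subtype.val_injective
  have hScard' : (S.image f).card = Group.rank A := by
    rw [Finset.card_image_of_injective _ hf, hScard]
  have hS' : Subgroup.closure ((S.image f : Finset _) : Set _) = A.map e.toMonoidHom := by
    rw [Finset.coe_image, ← MonoidHom.map_closure, hS, ← Subgroup.map_map,
      ← MonoidHom.range_eq_map, Subgroup.range_subtype]
  have hrel (c : C) : (A.map e.toMonoidHom).relIndex ((M c).map e.toMonoidHom) =
      A.relIndex (M c) := Subgroup.relIndex_map_map_of_injective _ _ e.injective
  have key := FreeGroup.card_le_of_isMaximalCyclic hS' (fun c => (M c).map e.toMonoidHom)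
    (fun c => (hM c).map e) (fun c => by rw [hrel]; exact hfin c)
    (fun c => by rw [hrel, hScard']; exact hlong c) (fun c d hcd g hg => by
      apply hcd
      apply Subtype.ext
      rw [hclass c, hclass d, ← subgroupConjClass_map_conj (M c) (e.symm g)]
      congr 1
      apply Subgroup.map_injective (f := e.toMonoidHom) e.injective
      rw [← hg, Subgroup.map_map, Subgroup.map_map]
      congr 1
      ext x
      simp)
  rw [hCcard, hScard'] at key
  omega
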